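/- Let $D=\{z\in\mathbb R^2: |z|<1\}$ and $S^1=\partial D$, and identify $S^1$ with $\mathbb R/\mathbb Z$ counterclockwise. All triangles are nondegenerate and are regarded as closed regions. For a triangle $T\subset D$ and $v\in S^1$ there are exactly two points $w\in S^1$ such that the segment $vw$ is tangent to $T$ (it meets $T$ but not the interior of $T$); let $\psi_T(v)$ be the one reached first when moving counterclockwise from $v$. The map $\psi_T$ is a homeomorphism of $S^1$; its rotation number is $\rho(\psi_T)=\lim_{n\to\infty}F^n(0)/n$, where $F:\mathbb R\to\mathbb R$ is the lift of $\psi_T$ with $F(0)\in(0,1)$. Let $\kappa(T)$ be the circumradius of $T$ if $T$ is acute, and half of the length of the largest side of $T$ if $T$ is right or obtuse. For a triangle $T$ in the plane, let $\mu(T)$ be the infimum of $\kappa(T')$ over all triangles $T'\subset D$ similar to $T$ such that $\rho(\psi_{T''})=\frac13$ for every triangle $T''\subset D$ congruent to $T'$ (similarity and congruence are Euclidean). **Proposition.** 1. $\mu(T)=\frac12$ for every equilateral triangle $T$. 2. For every equilateral triangle $T\subset D$ with circumradius at least $\frac12$, $\rho(\psi_T)=\frac13$, and there is a triangle $U$ inscribed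 in $S^1$ and circumscribing $T$, i.e. $T\subseteq U$ and each side of $U$ meets $T$. 3. The bound $\frac12$ is the smallest possible: for every $r$ with $0<r<\frac12$ there is an equilateral triangle $T\subset D$ with circumradius $r$ for which $\rho(\psi_T)>\frac13$ and no triangle inscribed in $S^1$ circumscribes $T$. -/

import Mathlib

open Set Filter Topology

noncomputable section

namespace BarBilliard

/-- The closed solid triangle spanned by the three vertices, in the Euclidean plane `ℂ`. -/
def region (T : Affine.Triangle ℝ ℂ) : Set ℂ :=
  convexHull ℝ (range T.points)

/-- The triangle lies in the open unit disk. -/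
def InDisk (T : Affine.Triangle ℝ ℂ) : Prop :=
  region T ⊆ Metric.ball (0 : ℂ) 1

/-- The segment with endpoints `v`, `w` is tangent to `T`: it touches the closed triangle but does
not meet its interior. -/
def IsTangent (T : Affine.Triangle ℝ ℂ) (v w : ℂ) : Prop :=
  (segment ℝ v w ∩ region T).Nonempty ∧ Disjoint (segment ℝ v w) (interior (region T))

/-- The projection `ℝ → S¹ = ℝ / ℤ`, with `S¹` realized as the unit circle in `ℂ`. -/
def proj (x : ℝ) : Circle :=
  Circle.exp (2 * Real.pi * x)

/-- The counterclockwise arc lengths `t ∈ (0, 1)` (measured in full turns, starting at `v`) of the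
points `w` of the unit circle for which the segment `v w` is tangent to `T`. For a triangle in the
open unit disk there are exactly two of them. -/
def tangentArcs (T : Affine.Triangle ℝ ℂ) (v : Circle) : Set ℝ :=
  {t | t ∈ Ioo (0 : ℝ) 1 ∧ IsTangent T (v : ℂ) ((proj t * v : Circle) : ℂ)}

/-- The bar billiard map: `v` goes to the endpoint `v₁` of a tangent segment `v v₁` that is reached
first when moving counterclockwise from `v`. -/
def psi (T : Affine.Triangle ℝ ℂ) (v : Circle) : Circle :=
  proj (sInf (tangentArcs T v)) * v

/-- `f : S¹ → S¹` has rotation number `ρ`: the continuous monotone degree one lift `F` of `f` with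
`F 0 ∈ (0, 1)` (there is at most one) exists, and `F^n 0 / n` tends to `ρ`. -/
def HasRotationNumber (f : Circle → Circle) (ρ : ℝ) : Prop :=
  ∃ F : CircleDeg1Lift, Continuous F ∧ (∀ x : ℝ, proj (F x) = f (proj x)) ∧
    F 0 ∈ Ioo (0 : ℝ) 1 ∧ F.translationNumber = ρ

open Classical in
/-- The circumradius of an acute triangle, and half of the length of the largest side of a right or
obtuse triangle. -/
def kappa (T : Affine.Triangle ℝ ℂ) : ℝ :=
  if T.AcuteAngled then T.circumradius
  else max (max (dist (T.points 0) (T.points 1)) (dist (T.points 1) (T.points 2)))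
    (dist (T.points 2) (T.points 0)) / 2

/-- The infimum of `kappa T'` over the triangles `T'` in the open unit disk that are similar to `T`
and such that every triangle in the open unit disk congruent to `T'` has rotation number `1/3`. -/
def mu (T : Affine.Triangle ℝ ℂ) : ℝ :=
  sInf {k : ℝ | ∃ T' : Affine.Triangle ℝ ℂ, InDisk T' ∧ Similar T'.points T.points ∧
    (∀ T'' : Affine.Triangle ℝ ℂ, InDisk T'' → Congruent T''.points T'.points →
      HasRotationNumber (psi T'') (1 / 3)) ∧
    k = kappa T'}

/-- The triangle `U` is inscribed in the unit circle. -/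
def IsInscribed (U : Affine.Triangle ℝ ℂ) : Prop :=
  ∀ i, ‖U.points i‖ = 1

/-- The triangle `U` circumscribes `T`: it contains `T` and each of its three sides touches `T`. -/
def Circumscribes (U T : Affine.Triangle ℝ ℂ) : Prop :=
  region T ⊆ region U ∧
    ∀ i j, i ≠ j → (segment ℝ (U.points i) (U.points j) ∩ region T).Nonempty

end BarBilliard

end

/-! For a point `p` of the disk, sending one end of a chord through `p` to the other is a Möbius
involution of the circle. Its lift `chordLift p` moves each point by less than a turn and its square
is translation by 1. The map `psi T` is lifted by `tangentLift`, the minimum of these lifts over the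
three vertices (`proj_tangentLift`). For any triangle some orbit of `tangentLift` completes a turn
within three steps (`exists_add_one_le_tangentLift_iterate`). If the Möbius product of the three
involutions is not elliptic, it fixes a point of the circle, and some orbit completes at most one
turn in three steps (`exists_tangentLift_iterate_le`). By the intermediate value theorem an orbit
then closes after exactly one turn in three steps. This gives rotation number 1/3, and the orbit
spans the circumscribing triangle. Comparing trace and determinant, non-ellipticity says that the
product of the `1 - ‖P i‖ ^ 2` is at most the square of twice the area. For an equilateral triangle
of circumradius at least 1/2 this follows from AM-GM (`one_sub_norm_sq_prod_le`). For sharpness,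
center the triangle at the origin with circumradius below 1/2. All chords through its vertices span
more than a third of a turn, and no inscribed triangle has all three sides that close to the center.
-/

namespace BarBilliard

open ComplexConjugate

/-! ### Chords of the circle through a point of the disk -/

/-- The counterclockwise arc, in full turns, from the point `v` of the unit circle to the other
endpoint of the chord through `v` and `p`. -/
noncomputable def chordArc (p v : ℂ) : ℝ :=
  1 / 2 - (1 - conj p * v).arg / Real.pi

/-- The unit direction of the chord from `v` to the point at arc `t`. -/
noncomputable def chordDir (v : ℂ) (t : ℝ) : ℂ :=
  v * (Complex.I * Complex.exp ((Real.pi * t : ℝ) * Complex.I))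

/-- The signed distance from `z` to the line from `v` to the point at arc `t`, positive to the
left. -/
noncomputable def chordSide (v : ℂ) (t : ℝ) (z : ℂ) : ℝ :=
  (conj (chordDir v t) * (z - v)).im

lemma re_one_sub_conj_mul_pos {p v : ℂ} (hp : ‖p‖ < 1) (hv : ‖v‖ = 1) :
    0 < (1 - conj p * v).re := by
  have h : (conj p * v).re ≤ ‖conj p * v‖ := Complex.re_le_norm _
  rw [norm_mul, hv, mul_one, Complex.norm_conj] at h
  simp only [Complex.sub_re, Complex.one_re]
  linarith

lemma one_sub_conj_mul_ne_zero {p v : ℂ} (hp : ‖p‖ < 1) (hv : ‖v‖ = 1) :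
    1 - conj p * v ≠ 0 := fun h => by
  have := re_one_sub_conj_mul_pos hp hv
  simp [h] at this

lemma abs_arg_one_sub_conj_mul_lt {p v : ℂ} (hp : ‖p‖ < 1) (hv : ‖v‖ = 1) :
    |(1 - conj p * v).arg| < Real.pi / 2 :=
  Complex.abs_arg_lt_pi_div_two_iff.2 (Or.inl (re_one_sub_conj_mul_pos hp hv))

lemma chordArc_mem_Ioo {p v : ℂ} (hp : ‖p‖ < 1) (hv : ‖v‖ = 1) :
    chordArc p v ∈ Ioo (0 : ℝ) 1 := by
  have h := abs_lt.1 (abs_arg_one_sub_conj_mul_lt hp hv)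
  have hpi := Real.pi_pos
  have h1 : (1 - conj p * v).arg / Real.pi < 1 / 2 := by
    rw [div_lt_iff₀ hpi]; linarith
  have h2 : -(1 / 2) < (1 - conj p * v).arg / Real.pi := by
    rw [lt_div_iff₀ hpi]; linarith
  unfold chordArc
  constructor <;> linarith

lemma pi_mul_chordArc (p v : ℂ) :
    Real.pi * chordArc p v = Real.pi / 2 - (1 - conj p * v).arg := by
  unfold chordArc
  field_simp [Real.pi_ne_zero]

lemma conj_mul_self_of_norm {v : ℂ} (hv : ‖v‖ = 1) : conj v * v = 1 := by
  rw [mul_comm, Complex.mul_conj, Complex.normSq_eq_norm_sq, hv]; norm_num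

lemma exp_pi_chordArc (p v : ℂ) :
    Complex.exp ((Real.pi * chordArc p v : ℝ) * Complex.I) =
      Complex.I * Complex.exp (-((1 - conj p * v).arg * Complex.I)) := by
  rw [pi_mul_chordArc]
  push_cast
  rw [sub_mul, sub_eq_add_neg, Complex.exp_add, Complex.exp_pi_div_two_mul_I]

lemma norm_mul_exp_neg_arg (u : ℂ) :
    (‖u‖ : ℂ) * Complex.exp (-(u.arg * Complex.I)) = conj u := by
  conv_rhs => rw [← Complex.norm_mul_exp_arg_mul_I u]
  rw [map_mul, Complex.conj_ofReal, ← Complex.exp_conj, map_mul, Complex.conj_ofReal,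
    Complex.conj_I, mul_neg]

/-- The position of `p` on the chord from `v` through `p`. -/
lemma sub_eq_norm_mul_chordDir {p v : ℂ} (hv : ‖v‖ = 1) :
    p - v = (‖1 - conj p * v‖ : ℂ) * chordDir v (chordArc p v) := by
  have h : (‖1 - conj p * v‖ : ℂ) * chordDir v (chordArc p v) =
      -(v * ((‖1 - conj p * v‖ : ℂ) * Complex.exp (-((1 - conj p * v).arg * Complex.I)))) := by
    unfold chordDir
    rw [exp_pi_chordArc]
    linear_combination (v * (‖1 - conj p * v‖ : ℂ) *
      Complex.exp (-((1 - conj p * v).arg * Complex.I))) * Complex.I_mul_I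
  rw [h, norm_mul_exp_neg_arg]
  simp only [map_sub, map_one, map_mul, Complex.conj_conj]
  linear_combination (-p) * conj_mul_self_of_norm hv

lemma conj_chordDir_mul_chordDir {v : ℂ} (hv : ‖v‖ = 1) (s t : ℝ) :
    conj (chordDir v t) * chordDir v s =
      Complex.exp ((Real.pi * (s - t) : ℝ) * Complex.I) := by
  unfold chordDir
  simp only [map_mul, Complex.conj_I, ← Complex.exp_conj, Complex.conj_ofReal]
  have : ((Real.pi * (s - t) : ℝ) : ℂ) * Complex.I =
      (Real.pi * t : ℝ) * -Complex.I + (Real.pi * s : ℝ) * Complex.I := by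
    push_cast; ring
  rw [this, Complex.exp_add]
  linear_combination (Complex.exp ((Real.pi * t : ℝ) * -Complex.I) *
    Complex.exp ((Real.pi * s : ℝ) * Complex.I)) * conj_mul_self_of_norm hv -
    (conj v * v * Complex.exp ((Real.pi * t : ℝ) * -Complex.I) *
    Complex.exp ((Real.pi * s : ℝ) * Complex.I)) * Complex.I_mul_I

lemma im_conj_chordDir_mul (c : ℝ) {v : ℂ} (hv : ‖v‖ = 1) (s t : ℝ) :
    (conj (chordDir v t) * (c * chordDir v s)).im = c * Real.sin (Real.pi * (s - t)) := by
  rw [mul_left_comm, conj_chordDir_mul_chordDir hv, Complex.im_ofReal_mul,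
    Complex.exp_ofReal_mul_I_im]

/-- Inscribed angles: the chords from `v` at arcs `s` and `t` meet at angle `π * (s - t)`, and `z`
lies on the first with `s = chordArc z v`, at distance `‖1 - conj z * v‖`. -/
lemma chordSide_eq {v : ℂ} (hv : ‖v‖ = 1) (t : ℝ) (z : ℂ) :
    chordSide v t z = ‖1 - conj z * v‖ * Real.sin (Real.pi * (chordArc z v - t)) := by
  unfold chordSide
  rw [sub_eq_norm_mul_chordDir hv, im_conj_chordDir_mul _ hv]

lemma coe_proj (t : ℝ) :
    ((proj t : Circle) : ℂ) = Complex.exp ((2 * Real.pi * t : ℝ) * Complex.I) := by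
  rw [proj, Circle.coe_exp]

lemma proj_add (s t : ℝ) : proj (s + t) = proj s * proj t := by
  simp only [proj, mul_add, Circle.exp_add]

lemma proj_mul_sub (v : ℂ) (t : ℝ) :
    (proj t : ℂ) * v - v = (2 * Real.sin (Real.pi * t) : ℝ) * chordDir v t := by
  rw [coe_proj]
  unfold chordDir
  have h1 : ((2 * Real.pi * t : ℝ) : ℂ) * Complex.I =
      (Real.pi * t : ℝ) * Complex.I + (Real.pi * t : ℝ) * Complex.I := by push_cast; ring
  rw [h1, Complex.exp_add, Complex.exp_mul_I, ← Complex.ofReal_cos, ← Complex.ofReal_sin]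
  have h2 : ((Real.cos (Real.pi * t) : ℝ) : ℂ) ^ 2 + ((Real.sin (Real.pi * t) : ℝ) : ℂ) ^ 2 = 1 := by
    rw [← Complex.ofReal_pow, ← Complex.ofReal_pow, ← Complex.ofReal_add, Real.cos_sq_add_sin_sq]
    simp
  push_cast at h2 ⊢
  linear_combination v * h2 - v * Complex.sin (Real.pi * t) ^ 2 * Complex.I_sq

lemma chordSide_proj_mul {v : ℂ} (hv : ‖v‖ = 1) (s t : ℝ) :
    chordSide v t (proj s * v) =
      2 * Real.sin (Real.pi * s) * Real.sin (Real.pi * (s - t)) := by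
  unfold chordSide
  rw [proj_mul_sub, im_conj_chordDir_mul _ hv]

lemma sin_pi_mul_pos {t : ℝ} (ht : t ∈ Ioo (0 : ℝ) 1) : 0 < Real.sin (Real.pi * t) :=
  Real.sin_pos_of_pos_of_lt_pi (mul_pos Real.pi_pos ht.1)
    (by nlinarith [Real.pi_pos, ht.2])

lemma chordSide_nonneg {p v : ℂ} (hp : ‖p‖ < 1) (hv : ‖v‖ = 1) {t : ℝ}
    (ht : 0 < t) (h : t ≤ chordArc p v) : 0 ≤ chordSide v t p := by
  rw [chordSide_eq hv]
  have := (chordArc_mem_Ioo hp hv).2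
  refine mul_nonneg (norm_nonneg _) (Real.sin_nonneg_of_nonneg_of_le_pi ?_ ?_)
  · exact mul_nonneg Real.pi_pos.le (by linarith)
  · nlinarith [Real.pi_pos]

lemma chordSide_pos {p v : ℂ} (hp : ‖p‖ < 1) (hv : ‖v‖ = 1) {t : ℝ}
    (ht : 0 < t) (h : t < chordArc p v) : 0 < chordSide v t p := by
  rw [chordSide_eq hv]
  have := (chordArc_mem_Ioo hp hv).2
  exact mul_pos (norm_pos_iff.2 (one_sub_conj_mul_ne_zero hp hv))
    (sin_pi_mul_pos ⟨by linarith, by linarith⟩)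

lemma chordSide_combo {v : ℂ} {t : ℝ} {x y : ℂ} {a b : ℝ} (hab : a + b = 1) :
    chordSide v t (a • x + b • y) = a * chordSide v t x + b * chordSide v t y := by
  have hb : b = 1 - a := by linarith
  subst hb
  have h : (a • x + (1 - a) • y) - v = (a : ℂ) * (x - v) + ((1 - a : ℝ) : ℂ) * (y - v) := by
    simp only [Complex.real_smul]; push_cast; ring
  unfold chordSide
  rw [h, mul_add, mul_left_comm, mul_left_comm (conj (chordDir v t)), Complex.add_im,
    Complex.im_ofReal_mul, Complex.im_ofReal_mul]

lemma chordSide_segment {v : ℂ} (hv : ‖v‖ = 1) {t : ℝ} {z : ℂ}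
    (hz : z ∈ segment ℝ v (proj t * v)) : chordSide v t z = 0 := by
  obtain ⟨a, b, -, -, hab, rfl⟩ := hz
  rw [chordSide_combo hab, chordSide_proj_mul hv]
  simp [chordSide]

lemma mem_segment_chordArc {p v : ℂ} (hp : ‖p‖ < 1) (hv : ‖v‖ = 1) :
    p ∈ segment ℝ v (proj (chordArc p v) * v) := by
  set t := chordArc p v with ht
  set u := 1 - conj p * v with hu
  have hs := sin_pi_mul_pos (chordArc_mem_Ioo hp hv)
  have hu0 : 0 < ‖u‖ := norm_pos_iff.2 (one_sub_conj_mul_ne_zero hp hv)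
  have hsin : ‖u‖ * Real.sin (Real.pi * t) = u.re := by
    rw [ht, pi_mul_chordArc, Real.sin_pi_div_two_sub, Complex.norm_mul_cos_arg]
  -- The distance from `v` to `p` does not exceed the chord length: `‖u‖ ^ 2 ≤ 2 * u.re` restates
  -- `‖1 - u‖ ≤ 1`.
  have hle : ‖u‖ ≤ 2 * Real.sin (Real.pi * t) := by
    have h1 : ‖u‖ ^ 2 ≤ 2 * u.re := by
      rw [← Complex.normSq_eq_norm_sq, Complex.normSq_apply]
      have h3 : ‖conj p * v‖ ^ 2 < 1 := by
        rw [norm_mul, hv, Complex.norm_conj, mul_one]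
        nlinarith [norm_nonneg p]
      rw [← Complex.normSq_eq_norm_sq, Complex.normSq_apply] at h3
      simp only [hu, Complex.sub_re, Complex.sub_im, Complex.one_re, Complex.one_im]
      nlinarith
    nlinarith
  rw [segment_eq_image']
  refine ⟨‖u‖ / (2 * Real.sin (Real.pi * t)), ⟨by positivity, ?_⟩, ?_⟩
  · exact (div_le_one (by positivity)).2 hle
  · have h1 := sub_eq_norm_mul_chordDir (p := p) hv
    simp only []
    rw [proj_mul_sub, Complex.real_smul, ← mul_assoc, ← Complex.ofReal_mul,
      div_mul_cancel₀ _ (by positivity)]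
    rw [← hu, ← ht] at h1
    rw [← h1]; ring

/-- The chord involution in Möbius form. -/
lemma proj_chordArc_mul {p v : ℂ} (hv : ‖v‖ = 1) :
    (proj (chordArc p v) : ℂ) * v * (1 - conj p * v) = p - v := by
  set u := 1 - conj p * v with hu
  have h1 : (proj (chordArc p v) : ℂ) =
      -(Complex.exp (-(u.arg * Complex.I)) * Complex.exp (-(u.arg * Complex.I))) := by
    have : ((2 * Real.pi * chordArc p v : ℝ) : ℂ) * Complex.I =
      (Real.pi * chordArc p v : ℝ) * Complex.I + (Real.pi * chordArc p v : ℝ) * Complex.I := by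
        push_cast; ring
    rw [coe_proj, this, Complex.exp_add, exp_pi_chordArc, ← hu]
    linear_combination (Complex.exp (-(u.arg * Complex.I)) * Complex.exp (-(u.arg * Complex.I)))
      * Complex.I_mul_I
  have h2 := norm_mul_exp_neg_arg u
  have h3 : Complex.exp (-(u.arg * Complex.I)) * u = ‖u‖ := by
    nth_rw 2 [← Complex.norm_mul_exp_arg_mul_I u]
    rw [mul_left_comm, ← Complex.exp_add]
    simp
  have h4 : conj u = 1 - p * conj v := by simp [hu]
  rw [h4] at h2
  rw [h1]
  linear_combination (-v * Complex.exp (-(u.arg * Complex.I))) * h3 - v * h2 +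
    p * conj_mul_self_of_norm hv

/-! ### Lifts of the chord involutions -/

/-- The lift to `ℝ` of the chord involution of the unit circle through `p`. -/
noncomputable def chordLift (p : ℂ) (x : ℝ) : ℝ :=
  x + chordArc p (proj x)

lemma proj_chordLift (p : ℂ) (x : ℝ) :
    proj (chordLift p x) = proj (chordArc p (proj x)) * proj x := by
  rw [chordLift, add_comm, proj_add]

lemma proj_chordLift_mul (p : ℂ) (x : ℝ) :
    (proj (chordLift p x) : ℂ) * (1 - conj p * proj x) = p - proj x := by
  rw [proj_chordLift, Circle.coe_mul]
  exact proj_chordArc_mul (Circle.norm_coe _)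

lemma proj_eq_proj {x y : ℝ} : proj x = proj y ↔ ∃ n : ℤ, x = y + n := by
  unfold proj
  rw [Circle.exp_eq_exp]
  refine exists_congr fun n => ?_
  have := Real.pi_pos
  constructor
  · intro h
    have : 2 * Real.pi * (x - (y + n)) = 0 := by linarith
    rcases mul_eq_zero.1 this with h | h
    · linarith
    · linarith
  · rintro rfl; ring

lemma proj_one : proj 1 = 1 := by simp [proj]

lemma proj_add_one (x : ℝ) : proj (x + 1) = proj x := by
  rw [proj_add, proj_one, mul_one]

lemma continuous_proj : Continuous proj := by
  unfold proj; fun_prop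

lemma chordLift_add_one (p : ℂ) (x : ℝ) : chordLift p (x + 1) = chordLift p x + 1 := by
  rw [chordLift, chordLift, proj_add_one]; ring

lemma chordArc_proj_mem {p : ℂ} (hp : ‖p‖ < 1) (x : ℝ) :
    chordArc p (proj x) ∈ Ioo (0 : ℝ) 1 :=
  chordArc_mem_Ioo hp (Circle.norm_coe _)

lemma lt_chordLift {p : ℂ} (hp : ‖p‖ < 1) (x : ℝ) : x < chordLift p x := by
  have := (chordArc_proj_mem hp x).1
  unfold chordLift; linarith

lemma chordLift_lt {p : ℂ} (hp : ‖p‖ < 1) (x : ℝ) : chordLift p x < x + 1 := by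
  have := (chordArc_proj_mem hp x).2
  unfold chordLift; linarith

/-- The Möbius relation is symmetric in the two ends of the chord, so the double step is an integer.
It is a sum of two arcs in `(0, 1)`, hence equals 1. -/
lemma chordLift_chordLift {p : ℂ} (hp : ‖p‖ < 1) (x : ℝ) :
    chordLift p (chordLift p x) = x + 1 := by
  have h1 := proj_chordLift_mul p x
  have h2 := proj_chordLift_mul p (chordLift p x)
  have h0 := one_sub_conj_mul_ne_zero hp (Circle.norm_coe (proj (chordLift p x)))
  have h : proj (chordLift p (chordLift p x)) = proj x := by
    refine Circle.ext (mul_right_cancel₀ h0 ?_)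
    rw [h2]
    linear_combination -h1
  obtain ⟨n, hn⟩ := proj_eq_proj.1 h
  have a1 := lt_chordLift hp x
  have a2 := lt_chordLift hp (chordLift p x)
  have a3 := chordLift_lt hp x
  have a4 := chordLift_lt hp (chordLift p x)
  have b1 : (0 : ℝ) < n := by linarith
  have b2 : (n : ℝ) < 2 := by linarith
  have c1 : (0 : ℤ) < n := by exact_mod_cast b1
  have c2 : n < 2 := by exact_mod_cast b2
  have : n = 1 := by omega
  rw [hn, this]; simp

lemma continuous_chordLift {p : ℂ} (hp : ‖p‖ < 1) : Continuous (chordLift p) := by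
  unfold chordLift chordArc
  refine continuous_id.add (continuous_const.sub (Continuous.div_const ?_ _))
  rw [continuous_iff_continuousAt]
  intro x
  have hc : Continuous fun x : ℝ => (1 - conj p * (proj x : ℂ)) :=
    continuous_const.sub (continuous_const.mul (continuous_subtype_val.comp continuous_proj))
  exact ContinuousAt.comp (f := fun x : ℝ => (1 - conj p * (proj x : ℂ)))
    (Complex.continuousAt_arg (Complex.mem_slitPlane_iff.2
      (Or.inl (re_one_sub_conj_mul_pos hp (Circle.norm_coe _))))) hc.continuousAt

lemma strictMono_chordLift {p : ℂ} (hp : ‖p‖ < 1) : StrictMono (chordLift p) := by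
  have hinj : Function.Injective (chordLift p) := fun x y h => by
    have h1 := chordLift_chordLift hp x
    rw [h, chordLift_chordLift hp y] at h1
    linarith
  rcases (continuous_chordLift hp).strictMono_of_inj hinj with h | h
  · exact h
  · have h1 := h (show (0 : ℝ) < 0 + 1 by norm_num)
    rw [chordLift_add_one] at h1
    linarith

/-- For two points of the disk there is a chord through both. -/
lemma exists_chordLift_eq {p q : ℂ} (hp : ‖p‖ < 1) (hq : ‖q‖ < 1) :
    ∃ x, chordLift p x = chordLift q x := by
  have key : ∀ {p q : ℂ}, ‖p‖ < 1 → ‖q‖ < 1 → ∃ x, chordLift p x ≤ chordLift q x := by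
    intro p q hp hq
    -- If one lift were everywhere strictly larger, so would be its square, but both squares are
    -- translation by 1.
    by_contra! h
    have h1 := (h (chordLift q 0)).trans (strictMono_chordLift hp (h 0))
    rw [chordLift_chordLift hp, chordLift_chordLift hq] at h1
    exact lt_irrefl _ h1
  obtain ⟨a, ha⟩ := key hp hq
  obtain ⟨b, hb⟩ := key hq hp
  exact intermediate_value_univ₂ (continuous_chordLift hp) (continuous_chordLift hq) ha hb

/-! ### The minimum of three chord lifts -/

/-- The lift of the tangent map around three points: the first among the three chords. -/
noncomputable def tangentLift (P : Fin 3 → ℂ) (x : ℝ) : ℝ :=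
  Finset.univ.inf' Finset.univ_nonempty fun i => chordLift (P i) x

lemma tangentLift_le (P : Fin 3 → ℂ) (i : Fin 3) (x : ℝ) :
    tangentLift P x ≤ chordLift (P i) x :=
  Finset.inf'_le _ (Finset.mem_univ i)

lemma exists_tangentLift_eq (P : Fin 3 → ℂ) (x : ℝ) :
    ∃ i, tangentLift P x = chordLift (P i) x := by
  obtain ⟨i, -, hi⟩ := Finset.exists_mem_eq_inf' Finset.univ_nonempty
    fun i => chordLift (P i) x
  exact ⟨i, hi⟩

variable {P : Fin 3 → ℂ}

lemma lt_tangentLift (hP : ∀ i, ‖P i‖ < 1) (x : ℝ) : x < tangentLift P x := by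
  obtain ⟨i, hi⟩ := exists_tangentLift_eq P x
  rw [hi]; exact lt_chordLift (hP i) x

lemma tangentLift_lt (hP : ∀ i, ‖P i‖ < 1) (x : ℝ) : tangentLift P x < x + 1 :=
  (tangentLift_le P 0 x).trans_lt (chordLift_lt (hP 0) x)

lemma tangentLift_strictMono (hP : ∀ i, ‖P i‖ < 1) : StrictMono (tangentLift P) := by
  intro x y hxy
  obtain ⟨i, hi⟩ := exists_tangentLift_eq P y
  rw [hi]
  exact (tangentLift_le P i x).trans_lt (strictMono_chordLift (hP i) hxy)

lemma continuous_tangentLift (hP : ∀ i, ‖P i‖ < 1) : Continuous (tangentLift P) :=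
  Continuous.finset_inf'_apply _ fun i _ => continuous_chordLift (hP i)

lemma tangentLift_add_one (P : Fin 3 → ℂ) (x : ℝ) :
    tangentLift P (x + 1) = tangentLift P x + 1 := by
  apply le_antisymm
  · obtain ⟨i, hi⟩ := exists_tangentLift_eq P x
    rw [hi, ← chordLift_add_one]
    exact tangentLift_le P i _
  · obtain ⟨i, hi⟩ := exists_tangentLift_eq P (x + 1)
    rw [hi, chordLift_add_one]
    linarith [tangentLift_le P i x]

/-- `tangentLift` as a degree one lift. -/
noncomputable def tangentDeg1Lift (P : Fin 3 → ℂ) (hP : ∀ i, ‖P i‖ < 1) : CircleDeg1Lift where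
  toFun := tangentLift P
  monotone' := (tangentLift_strictMono hP).monotone
  map_add_one' := tangentLift_add_one P

lemma tangentDeg1Lift_apply (hP : ∀ i, ‖P i‖ < 1) (x : ℝ) :
    tangentDeg1Lift P hP x = tangentLift P x := rfl

/-! ### The minimum lifts the tangent map of the triangle -/

section Triangle

variable {T : Affine.Triangle ℝ ℂ}

lemma InDisk.norm_lt (hT : InDisk T) (i : Fin 3) : ‖T.points i‖ < 1 := by
  simpa using hT (subset_convexHull ℝ _ (mem_range_self i))

lemma convex_chordSide_nonneg (v : ℂ) (t : ℝ) : Convex ℝ {z | 0 ≤ chordSide v t z} := by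
  intro x hx y hy a b ha hb hab
  rw [mem_ofPred_eq, chordSide_combo hab]
  exact add_nonneg (mul_nonneg ha hx) (mul_nonneg hb hy)

lemma convex_chordSide_pos (v : ℂ) (t : ℝ) : Convex ℝ {z | 0 < chordSide v t z} := by
  intro x hx y hy a b ha hb hab
  rw [mem_ofPred_eq] at hx hy ⊢
  rw [chordSide_combo hab]
  rcases ha.eq_or_lt with rfl | ha
  · obtain rfl : b = 1 := by linarith
    linarith
  · have := mul_pos ha hx
    have := mul_nonneg hb hy.le
    linarith

lemma region_subset_of_forall_points {s : Set ℂ} (hs : Convex ℝ s) (h : ∀ i, T.points i ∈ s) :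
    region T ⊆ s :=
  convexHull_min (range_subset_iff.2 h) hs

lemma tangentLift_sub_mem (hT : InDisk T) (x : ℝ) :
    tangentLift T.points x - x ∈ Ioo (0 : ℝ) 1 := by
  have h1 := lt_tangentLift hT.norm_lt x
  have h2 := tangentLift_lt hT.norm_lt x
  constructor <;> linarith

lemma region_subset_chordSide_nonneg (hT : InDisk T) (x : ℝ) :
    region T ⊆ {z | 0 ≤ chordSide (proj x) (tangentLift T.points x - x) z} := by
  refine region_subset_of_forall_points (convex_chordSide_nonneg _ _) fun i => ?_
  refine chordSide_nonneg (hT.norm_lt i) (Circle.norm_coe _) (tangentLift_sub_mem hT x).1 ?_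
  have := tangentLift_le T.points i x
  unfold chordLift at this
  linarith

lemma proj_sub_mul (x y : ℝ) : proj (y - x) * proj x = proj y := by
  rw [← proj_add]; congr 1; ring

lemma segment_inter_region_nonempty (hT : InDisk T) (x : ℝ) :
    (segment ℝ (proj x : ℂ) (proj (tangentLift T.points x)) ∩ region T).Nonempty := by
  obtain ⟨i, hi⟩ := exists_tangentLift_eq T.points x
  refine ⟨T.points i, ?_, subset_convexHull ℝ _ (mem_range_self i)⟩
  rw [hi, proj_chordLift, Circle.coe_mul]
  exact mem_segment_chordArc (hT.norm_lt i) (Circle.norm_coe _)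

/-- An interior point on the line could be pushed by `ε / 2` to its right without leaving `s`. -/
lemma chordSide_ne_zero_of_mem_interior {v : ℂ} (hv : ‖v‖ = 1) {t : ℝ} {s : Set ℂ}
    (hs : s ⊆ {z | 0 ≤ chordSide v t z}) {z : ℂ} (hz : z ∈ interior s) :
    chordSide v t z ≠ 0 := by
  intro h0
  obtain ⟨ε, hε, hball⟩ := Metric.isOpen_iff.1 isOpen_interior z hz
  have hd : ‖chordDir v t‖ = 1 := by
    simp [chordDir, hv, Complex.norm_exp]
  set w : ℂ := z - (ε / 2 : ℝ) * (Complex.I * chordDir v t) with hw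
  have hwm : w ∈ Metric.ball z ε := by
    rw [Metric.mem_ball, dist_eq_norm, hw, sub_sub_cancel_left, norm_neg, norm_mul, norm_mul, hd,
      Complex.norm_I, Complex.norm_real, Real.norm_of_nonneg (by positivity)]
    linarith
  have h1 : 0 ≤ chordSide v t w := hs (interior_subset (hball hwm))
  have h2 : chordSide v t w = chordSide v t z - ε / 2 := by
    unfold chordSide
    have : conj (chordDir v t) * (w - v) = conj (chordDir v t) * (z - v) -
        ((ε / 2 : ℝ) : ℂ) * (Complex.I * (chordDir v t * conj (chordDir v t))) := by
      rw [hw]; ring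
    rw [this, Complex.mul_conj, Complex.normSq_eq_norm_sq, hd, Complex.sub_im,
      Complex.im_ofReal_mul]
    simp
  linarith

lemma isTangent_tangentLift (hT : InDisk T) (x : ℝ) :
    IsTangent T (proj x) (proj (tangentLift T.points x)) := by
  refine ⟨segment_inter_region_nonempty hT x, Set.disjoint_left.2 fun z hz hzi => ?_⟩
  refine chordSide_ne_zero_of_mem_interior (Circle.norm_coe (proj x))
    (region_subset_chordSide_nonneg hT x) hzi (chordSide_segment (Circle.norm_coe _) ?_)
  rwa [← Circle.coe_mul, proj_sub_mul]

/-- At any smaller positive arc the three vertices, hence the whole region, lie strictly to the left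
of the chord, which therefore misses the triangle. -/
lemma isLeast_tangentArcs (hT : InDisk T) (x : ℝ) :
    IsLeast (tangentArcs T (proj x)) (tangentLift T.points x - x) := by
  refine ⟨⟨tangentLift_sub_mem hT x, ?_⟩, fun t ht => ?_⟩
  · rw [proj_sub_mul]; exact isTangent_tangentLift hT x
  · by_contra! hlt
    obtain ⟨⟨ht0, -⟩, ⟨z, hzs, hzr⟩, -⟩ := ht
    have hz : 0 < chordSide (proj x) t z := by
      refine region_subset_of_forall_points (convex_chordSide_pos _ _) (fun i => ?_) hzr
      refine chordSide_pos (hT.norm_lt i) (Circle.norm_coe _) ht0 ?_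
      have := tangentLift_le T.points i x
      unfold chordLift at this
      linarith
    rw [Circle.coe_mul] at hzs
    exact hz.ne' (chordSide_segment (Circle.norm_coe _) hzs)

lemma proj_tangentLift (hT : InDisk T) (x : ℝ) :
    proj (tangentLift T.points x) = psi T (proj x) := by
  rw [psi, (isLeast_tangentArcs hT x).csInf_eq, proj_sub_mul]

lemma hasRotationNumber_translationNumber (hT : InDisk T) :
    HasRotationNumber (psi T) (tangentDeg1Lift T.points hT.norm_lt).translationNumber := by
  refine ⟨tangentDeg1Lift T.points hT.norm_lt, continuous_tangentLift hT.norm_lt,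
    proj_tangentLift hT, ?_, rfl⟩
  simpa [tangentDeg1Lift_apply] using tangentLift_sub_mem hT 0

end Triangle

/-! ### Uniqueness of the rotation number, and an orbit making a turn in three steps -/

lemma HasRotationNumber.unique {f : Circle → Circle} {ρ σ : ℝ} (hρ : HasRotationNumber f ρ)
    (hσ : HasRotationNumber f σ) : ρ = σ := by
  obtain ⟨F, hFc, hF, hF0, rfl⟩ := hρ
  obtain ⟨G, hGc, hG, hG0, rfl⟩ := hσ
  have hn : ∀ x, ∃ n : ℤ, F x = G x + n := fun x => proj_eq_proj.1 ((hF x).trans (hG x).symm)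
  choose n hn using hn
  have hc : Continuous fun x => ((n x : ℤ) : ℝ) := by
    have : (fun x => ((n x : ℤ) : ℝ)) = fun x => F x - G x := by
      funext x; rw [hn x]; ring
    rw [this]; exact hFc.sub hGc
  have hc' : Continuous n := Int.isClosedEmbedding_coe_real.isInducing.continuous_iff.2 hc
  have h0 : n 0 = 0 := by
    have := hn 0
    have h1 : (-1 : ℝ) < n 0 := by linarith [hF0.1, hG0.2]
    have h2 : (n 0 : ℝ) < 1 := by linarith [hF0.2, hG0.1]
    have h3 : -1 < n 0 := by exact_mod_cast h1
    have h4 : n 0 < 1 := by exact_mod_cast h2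
    omega
  have : F = G := CircleDeg1Lift.ext fun x => by
    rw [hn x, PreconnectedSpace.constant inferInstance hc' (y := 0), h0]; simp
  rw [this]

/-- Some orbit needs at most three steps to make a full turn. -/
lemma exists_add_one_le_tangentLift_iterate (hP : ∀ i, ‖P i‖ < 1) :
    ∃ x, x + 1 ≤ tangentLift P (tangentLift P (tangentLift P x)) := by
  -- Suppose the first step runs along the line through `P 0` and `P 1`, ending at `y`. Both of
  -- these involutions send `y` to `x + 1`, so using either again after `y` reaches at least `x +
  -- 1`. Otherwise `P 2` is used twice, which leads to `y + 1`.
  have key : ∀ x, tangentLift P x = chordLift (P 0) x → tangentLift P x = chordLift (P 1) x →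
      x + 1 ≤ tangentLift P (tangentLift P (tangentLift P x)) := by
    intro x h0 h1
    have e0 : chordLift (P 0) (tangentLift P x) = x + 1 := by rw [h0, chordLift_chordLift (hP 0)]
    have e1 : chordLift (P 1) (tangentLift P x) = x + 1 := by rw [h1, chordLift_chordLift (hP 1)]
    set y := tangentLift P x
    have hxy : x < y := lt_tangentLift hP x
    have hy : y < tangentLift P y := lt_tangentLift hP y
    obtain ⟨j, hj⟩ := exists_tangentLift_eq P y
    obtain ⟨k, hk⟩ := exists_tangentLift_eq P (tangentLift P y)
    have hyy := lt_tangentLift hP (tangentLift P y)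
    fin_cases j
    · have : tangentLift P y = chordLift (P 0) y := hj
      linarith
    · have : tangentLift P y = chordLift (P 1) y := hj
      linarith
    · replace hj : tangentLift P y = chordLift (P 2) y := hj
      rw [hk]
      fin_cases k
      · exact e0.symm.le.trans (strictMono_chordLift (hP 0) hy).le
      · exact e1.symm.le.trans (strictMono_chordLift (hP 1) hy).le
      · change x + 1 ≤ chordLift (P 2) (tangentLift P y)
        rw [hj, chordLift_chordLift (hP 2)]
        linarith
  have key' : ∀ x, chordLift (P 0) x = chordLift (P 1) x →
      chordLift (P 0) x ≤ chordLift (P 2) x →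
      x + 1 ≤ tangentLift P (tangentLift P (tangentLift P x)) := by
    intro x h1 h2
    have : tangentLift P x = chordLift (P 0) x := by
      refine le_antisymm (tangentLift_le P 0 x) (Finset.le_inf' _ _ fun i _ => ?_)
      fin_cases i
      · exact le_rfl
      · exact h1.le
      · exact h2
    exact key x this (this.trans h1)
  obtain ⟨x, hx⟩ := exists_chordLift_eq (hP 0) (hP 1)
  rcases le_total (chordLift (P 0) x) (chordLift (P 2) x) with h | h
  · exact ⟨x, key' x hx h⟩
  -- Traversing the chord from its other end puts `P 2` on the other side.
  · refine ⟨chordLift (P 0) x, key' _ ?_ ?_⟩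
    · rw [chordLift_chordLift (hP 0), hx, chordLift_chordLift (hP 1)]
    · rw [chordLift_chordLift (hP 0), ← chordLift_chordLift (hP 2) x]
      exact (strictMono_chordLift (hP 2)).monotone h

/-! ### Fixed points of the product of three involutions -/

/-- Twice the signed area of the triangle `a b c`. -/
def doubleArea (a b c : ℂ) : ℝ :=
  (conj a * b + conj b * c + conj c * a).im

lemma exists_im_mul_eq {b : ℂ} {s : ℝ} (h : |s| ≤ ‖b‖) :
    ∃ v : Circle, (conj b * v).im = s := by
  have hs : s / ‖b‖ ∈ Icc (-1 : ℝ) 1 := by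
    rw [mem_Icc, ← abs_le, abs_div, abs_norm]
    exact div_le_one_of_le₀ h (norm_nonneg _)
  refine ⟨Circle.exp (b.arg + Real.arcsin (s / ‖b‖)), ?_⟩
  have e : conj b * (Circle.exp (b.arg + Real.arcsin (s / ‖b‖)) : ℂ) =
      ‖b‖ * Complex.exp (Real.arcsin (s / ‖b‖) * Complex.I) := by
    conv_lhs => rw [← norm_mul_exp_neg_arg b]
    rw [Circle.coe_exp, mul_assoc, ← Complex.exp_add]
    congr 2
    push_cast; ring
  rw [e, Complex.im_ofReal_mul, Complex.exp_ofReal_mul_I_im, Real.sin_arcsin hs.1 hs.2]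
  rcases eq_or_ne ‖b‖ 0 with h0 | h0
  · rw [h0] at h ⊢
    rw [abs_nonpos_iff.1 h]; simp
  · field_simp

/-- The Möbius transformation with matrix `(α, β; conj β, conj α)` fixes a point of the unit
circle when it is not elliptic. -/
lemma exists_circle_fixed {α β : ℂ} (h : ‖α‖ ^ 2 - ‖β‖ ^ 2 ≤ α.re ^ 2) :
    ∃ v : Circle, α * v + β = v * (conj β * v + conj α) := by
  -- On the unit circle, dividing the fixed point equation by `v` turns it into `(conj β * v).im =
  -- α.im`, solvable exactly under this bound.
  have h1 : |α.im| ≤ ‖β‖ := by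
    rw [← Complex.normSq_eq_norm_sq α, Complex.normSq_apply] at h
    refine abs_le_of_sq_le_sq (by nlinarith) (norm_nonneg _)
  obtain ⟨v, hv⟩ := exists_im_mul_eq h1
  refine ⟨v, ?_⟩
  have hv1 := conj_mul_self_of_norm (Circle.norm_coe v)
  have e1 : α - conj α = (2 * α.im : ℝ) * Complex.I := Complex.sub_conj α
  have e2 : conj β * v - conj (conj β * v) = (2 * α.im : ℝ) * Complex.I := by
    rw [Complex.sub_conj, hv]
  rw [map_mul, Complex.conj_conj] at e2
  linear_combination (v : ℂ) * e1 - (v : ℂ) * e2 - β * hv1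

/-- The three chord involutions, composed, fix a point of the unit circle when the triangle is
large enough. -/
lemma exists_proj_chordLift_fixed {a b c : ℂ} (ha : ‖a‖ < 1) (hb : ‖b‖ < 1) (hc : ‖c‖ < 1)
    (h : (1 - ‖a‖ ^ 2) * (1 - ‖b‖ ^ 2) * (1 - ‖c‖ ^ 2) ≤ doubleArea a b c ^ 2) :
    ∃ x, proj (chordLift c (chordLift b (chordLift a x))) = proj x := by
  -- First row of the product of the matrices `(-1, p; -conj p, 1)` for `c`, `b`, `a`, each
  -- multiplied by `Complex.I` to bring it to the form `(α, β; conj β, conj α)`.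
  set α : ℂ := Complex.I * (1 - b * conj a - c * conj b + c * conj a) with hα
  set β : ℂ := Complex.I * (b - a - c + a * conj b * c) with hβ
  have hre : α.re = doubleArea a b c := by
    simp [hα, doubleArea]; ring
  have hdet : ‖α‖ ^ 2 - ‖β‖ ^ 2 = (1 - ‖a‖ ^ 2) * (1 - ‖b‖ ^ 2) * (1 - ‖c‖ ^ 2) := by
    simp only [← Complex.normSq_eq_norm_sq, Complex.normSq_apply]
    simp [hα, hβ]; ring
  obtain ⟨v, hv⟩ := exists_circle_fixed (α := α) (β := β) (by rw [hre, hdet]; exact h)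
  obtain ⟨x, rfl⟩ : ∃ x, proj x = v := by
    refine ⟨(v : ℂ).arg / (2 * Real.pi), ?_⟩
    have := Real.pi_pos
    rw [proj, mul_div_cancel₀ _ (by positivity), Circle.exp_arg]
  refine ⟨x, ?_⟩
  have e1 := proj_chordLift_mul a x
  have e2 := proj_chordLift_mul b (chordLift a x)
  have e3 := proj_chordLift_mul c (chordLift b (chordLift a x))
  have n1 := one_sub_conj_mul_ne_zero ha (Circle.norm_coe (proj x))
  have n2 := one_sub_conj_mul_ne_zero hb (Circle.norm_coe (proj (chordLift a x)))
  have n3 := one_sub_conj_mul_ne_zero hc (Circle.norm_coe (proj (chordLift b (chordLift a x))))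
  set w1 : ℂ := (proj (chordLift a x) : ℂ)
  set w2 : ℂ := (proj (chordLift b (chordLift a x)) : ℂ)
  set w3 : ℂ := (proj (chordLift c (chordLift b (chordLift a x))) : ℂ) with hw3
  set w : ℂ := (proj x : ℂ) with hw
  refine Circle.ext ?_
  rw [← hw3, ← hw]
  refine mul_right_cancel₀ (mul_ne_zero (mul_ne_zero n1 n2) n3) ?_
  simp only [hα, hβ, map_mul, map_add, map_sub, map_one, Complex.conj_I, Complex.conj_conj] at hv
  have d2 : (1 - conj a * w) * (1 - conj b * w1) = 1 - conj a * w - conj b * (a - w) := by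
    linear_combination (-conj b) * e1
  have m2 : w2 * ((1 - conj a * w) * (1 - conj b * w1)) = b * (1 - conj a * w) - (a - w) := by
    linear_combination (1 - conj a * w) * e2 - e1
  have d3 : (1 - conj a * w) * (1 - conj b * w1) * (1 - conj c * w2) =
      1 - conj a * w - conj b * (a - w) - conj c * (b * (1 - conj a * w) - (a - w)) := by
    linear_combination d2 - conj c * m2
  have m3 : w3 * ((1 - conj a * w) * (1 - conj b * w1) * (1 - conj c * w2)) =
      c * (1 - conj a * w - conj b * (a - w)) - (b * (1 - conj a * w) - (a - w)) := by
    linear_combination ((1 - conj a * w) * (1 - conj b * w1)) * e3 + c * d2 - m2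
  rw [m3, d3]
  linear_combination Complex.I * hv +
    (c * (1 - conj a * w - conj b * (a - w)) - (b * (1 - conj a * w) - (a - w)) -
      w * (1 - conj a * w - conj b * (a - w) - conj c * (b * (1 - conj a * w) - (a - w)))) *
      Complex.I_mul_I

lemma exists_tangentLift_iterate_le {P : Fin 3 → ℂ} (hP : ∀ i, ‖P i‖ < 1)
    (h : (1 - ‖P 0‖ ^ 2) * (1 - ‖P 1‖ ^ 2) * (1 - ‖P 2‖ ^ 2) ≤
      doubleArea (P 0) (P 1) (P 2) ^ 2) :
    ∃ x, tangentLift P (tangentLift P (tangentLift P x)) ≤ x + 1 := by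
  have hmono := fun i => (strictMono_chordLift (hP i)).monotone
  have hle : ∀ i j k x, tangentLift P (tangentLift P (tangentLift P x)) ≤
      chordLift (P k) (chordLift (P j) (chordLift (P i) x)) := by
    intro i j k x
    have h1 := tangentLift_le P i x
    have h2 := (tangentLift_le P j _).trans (hmono j h1)
    exact (tangentLift_le P k _).trans (hmono k h2)
  obtain ⟨x, hx⟩ := exists_proj_chordLift_fixed (hP 0) (hP 1) (hP 2) h
  obtain ⟨n, hn⟩ := proj_eq_proj.1 hx
  have a1 := lt_chordLift (hP 0) x
  have a2 := lt_chordLift (hP 1) (chordLift (P 0) x)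
  have a3 := lt_chordLift (hP 2) (chordLift (P 1) (chordLift (P 0) x))
  have b1 := chordLift_lt (hP 0) x
  have b2 := chordLift_lt (hP 1) (chordLift (P 0) x)
  have b3 := chordLift_lt (hP 2) (chordLift (P 1) (chordLift (P 0) x))
  have c1 : (0 : ℝ) < n := by linarith
  have c2 : (n : ℝ) < 3 := by linarith
  have d1 : (0 : ℤ) < n := by exact_mod_cast c1
  have d2 : n < 3 := by exact_mod_cast c2
  obtain rfl | rfl : n = 1 ∨ n = 2 := by omega
  · exact ⟨x, (hle 0 1 2 x).trans (by rw [hn]; simp)⟩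
  -- If the composition advances by two turns, the reverse composition cancels it up to three unit
  -- translations, hence advances by `3 - 2 = 1`.
  · refine ⟨chordLift (P 2) (chordLift (P 1) (chordLift (P 0) x)), (hle 2 1 0 _).trans ?_⟩
    rw [chordLift_chordLift (hP 2), chordLift_add_one, chordLift_chordLift (hP 1),
      chordLift_add_one, chordLift_add_one, chordLift_chordLift (hP 0), hn]
    push_cast; linarith

lemma exists_tangentLift_iterate_eq {P : Fin 3 → ℂ} (hP : ∀ i, ‖P i‖ < 1)
    (h : (1 - ‖P 0‖ ^ 2) * (1 - ‖P 1‖ ^ 2) * (1 - ‖P 2‖ ^ 2) ≤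
      doubleArea (P 0) (P 1) (P 2) ^ 2) :
    ∃ x, tangentLift P (tangentLift P (tangentLift P x)) = x + 1 := by
  obtain ⟨a, ha⟩ := exists_tangentLift_iterate_le hP h
  obtain ⟨b, hb⟩ := exists_add_one_le_tangentLift_iterate hP
  have hc := continuous_tangentLift hP
  exact intermediate_value_univ₂ (hc.comp (hc.comp hc)) (continuous_add_const 1) ha hb

/-! ### Consequences of an orbit closing after three steps -/

lemma hasRotationNumber_one_third {T : Affine.Triangle ℝ ℂ} (hT : InDisk T) {x : ℝ}
    (hx : tangentLift T.points (tangentLift T.points (tangentLift T.points x)) = x + 1) :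
    HasRotationNumber (psi T) (1 / 3) := by
  have h := hasRotationNumber_translationNumber hT
  have h3 : (tangentDeg1Lift T.points hT.norm_lt ^ 3) x = x + (1 : ℤ) := by
    rw [Int.cast_one, ← hx]; rfl
  rw [CircleDeg1Lift.translationNumber_of_map_pow_eq_add_int _ h3 (by norm_num)] at h
  simpa using h

lemma sin_pi_mul_chordSide {x y : ℝ} (z : ℂ) :
    2 * Real.sin (Real.pi * (y - x)) * chordSide (proj x) (y - x) z =
      (conj ((proj y : ℂ) - proj x) * (z - proj x)).im := by
  have h := proj_mul_sub (proj x) (y - x)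
  rw [← Circle.coe_mul, proj_sub_mul] at h
  rw [h, map_mul, Complex.conj_ofReal, mul_assoc ((_ : ℝ) : ℂ), Complex.im_ofReal_mul, chordSide]

/-- A point to the left of the three sides of a counterclockwise triangle lies in it. -/
lemma mem_convexHull_of_left {a b c z : ℂ}
    (hD : 0 < (conj (b - a) * (c - a)).im) (hab : 0 ≤ (conj (b - a) * (z - a)).im)
    (hbc : 0 ≤ (conj (c - b) * (z - b)).im) (hca : 0 ≤ (conj (a - c) * (z - c)).im) :
    z ∈ convexHull ℝ (range ![a, b, c]) := by
  set D := (conj (b - a) * (c - a)).im with hDdef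
  set p := (conj (b - a) * (z - a)).im with hp
  set q := (conj (c - b) * (z - b)).im with hq
  set r := (conj (a - c) * (z - c)).im with hr
  have hsum : q + r + p = D := by
    simp [hDdef, hp, hq, hr]; ring
  have hz : (q / D) • a + (r / D) • b + (p / D) • c = z := by
    have hD' : (D : ℂ) ≠ 0 := Complex.ofReal_ne_zero.2 hD.ne'
    apply mul_left_cancel₀ hD'
    have e : (q : ℂ) * a + r * b + p * c = D * z := by
      apply Complex.ext <;> simp [hDdef, hp, hq, hr] <;> ring
    rw [← e]
    simp only [Complex.real_smul, Complex.ofReal_div]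
    field_simp
  have hv : ∀ i, (![a, b, c] : Fin 3 → ℂ) i ∈ convexHull ℝ (range ![a, b, c]) :=
    fun i => subset_convexHull ℝ _ (mem_range_self i)
  have hw := (convex_convexHull ℝ (range ![a, b, c])).sum_mem (t := Finset.univ)
    (w := ![q / D, r / D, p / D]) (z := ![a, b, c])
    (fun i _ => by fin_cases i <;> simp <;> positivity)
    (by simp [Fin.sum_univ_three]; rw [← add_div, ← add_div, hsum, div_self hD.ne'])
    (fun i _ => hv i)
  simp only [Fin.sum_univ_three, Matrix.cons_val_zero, Matrix.cons_val_one,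
    Matrix.cons_val_two, Matrix.head_cons, Matrix.tail_cons] at hw
  rw [← hz]
  exact hw

/-- The triangle with three prescribed distinct vertices on a circle about the origin. -/
def triangleOfNorm (p : Fin 3 → ℂ) (r : ℝ) (hr : ∀ i, ‖p i‖ = r) (hp : Function.Injective p) :
    Affine.Triangle ℝ ℂ :=
  ⟨p, EuclideanGeometry.Cospherical.affineIndependent (s := range p)
    ⟨0, r, by rintro _ ⟨i, rfl⟩; simpa using hr i⟩ Subset.rfl hp⟩

/-- The three orbit points are in counterclockwise order because the steps add up to one turn. Each
side is a tangent chord with `T` on its left. -/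
lemma exists_circumscribes {T : Affine.Triangle ℝ ℂ} (hT : InDisk T) {x : ℝ}
    (hx : tangentLift T.points (tangentLift T.points (tangentLift T.points x)) = x + 1) :
    ∃ U : Affine.Triangle ℝ ℂ, IsInscribed U ∧ Circumscribes U T := by
  have hm := tangentLift_sub_mem hT
  set F := tangentLift T.points with hF
  set y := F x with hy
  set z := F y with hz
  have m1 := hm x
  have m2 := hm y
  have m3 := hm z
  rw [← hy] at m1
  rw [← hz] at m2
  rw [hx] at m3
  have q1 : proj (x + 1) = proj x := proj_add_one x
  have s1 := segment_inter_region_nonempty hT x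
  have s2 := segment_inter_region_nonempty hT y
  have s3 := segment_inter_region_nonempty hT z
  rw [← hF, ← hy] at s1
  rw [← hF, ← hz] at s2
  rw [← hF, hx, q1] at s3
  have l1 : ∀ w ∈ region T, 0 ≤ (conj ((proj y : ℂ) - proj x) * (w - proj x)).im := by
    intro w hw
    rw [← sin_pi_mul_chordSide]
    exact mul_nonneg (by linarith [sin_pi_mul_pos m1]) (region_subset_chordSide_nonneg hT x hw)
  have l2 : ∀ w ∈ region T, 0 ≤ (conj ((proj z : ℂ) - proj y) * (w - proj y)).im := by
    intro w hw
    rw [← sin_pi_mul_chordSide]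
    exact mul_nonneg (by linarith [sin_pi_mul_pos m2]) (region_subset_chordSide_nonneg hT y hw)
  have l3 : ∀ w ∈ region T, 0 ≤ (conj ((proj x : ℂ) - proj z) * (w - proj z)).im := by
    intro w hw
    rw [← q1, ← sin_pi_mul_chordSide]
    have := region_subset_chordSide_nonneg hT z hw
    rw [← hF, hx] at this
    exact mul_nonneg (by linarith [sin_pi_mul_pos m3]) this
  have hD : 0 < (conj ((proj y : ℂ) - proj x) * (proj z - proj x)).im := by
    have := chordSide_proj_mul (Circle.norm_coe (proj x)) (z - x) (y - x)
    rw [← Circle.coe_mul, proj_sub_mul] at this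
    rw [← sin_pi_mul_chordSide, this]
    have hzx : z - x ∈ Ioo (0 : ℝ) 1 := ⟨by linarith [m1.1, m2.1], by linarith [m3.1]⟩
    have hzy : z - x - (y - x) ∈ Ioo (0 : ℝ) 1 := by
      rw [sub_sub_sub_cancel_right]; exact m2
    have p1 := sin_pi_mul_pos m1
    have p2 := sin_pi_mul_pos hzx
    have p3 := sin_pi_mul_pos hzy
    positivity
  have hinj : Function.Injective ![(proj x : ℂ), proj y, proj z] := by
    have n1 : (proj x : ℂ) ≠ proj y := fun h => by rw [h] at hD; simp at hD
    have n2 : (proj x : ℂ) ≠ proj z := fun h => by rw [h] at hD; simp at hD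
    have n3 : (proj y : ℂ) ≠ proj z := fun h => by
      rw [h, mul_comm, Complex.mul_conj] at hD; simp at hD
    intro i j hij
    fin_cases i <;> fin_cases j <;> simp_all
  refine ⟨triangleOfNorm ![(proj x : ℂ), proj y, proj z] 1
    (fun i => by fin_cases i <;> exact Circle.norm_coe _) hinj,
    fun i => by fin_cases i <;> exact Circle.norm_coe _, fun w hw => ?_, fun i j hij => ?_⟩
  · exact mem_convexHull_of_left hD (l1 w hw) (l2 w hw) (l3 w hw)
  · fin_cases i <;> fin_cases j
    · exact absurd rfl hij
    · exact s1
    · rw [segment_symm]; exact s3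
    · rw [segment_symm]; exact s1
    · exact absurd rfl hij
    · exact s2
    · exact s3
    · rw [segment_symm]; exact s2
    · exact absurd rfl hij

/-! ### Equilateral triangles of circumradius at least 1/2 -/

lemma dist_sq_eq (z w : ℂ) : dist z w ^ 2 = (z.re - w.re) ^ 2 + (z.im - w.im) ^ 2 := by
  rw [dist_eq_norm, ← Complex.normSq_eq_norm_sq, Complex.normSq_apply, Complex.sub_re,
    Complex.sub_im]
  ring

lemma norm_sq_eq (z : ℂ) : ‖z‖ ^ 2 = z.re ^ 2 + z.im ^ 2 := by
  rw [← Complex.normSq_eq_norm_sq, Complex.normSq_apply]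
  ring

/-- The side of an equilateral triangle is `√3` times its circumradius. -/
lemma dist_sq_eq_three_mul_circumradius_sq {T : Affine.Triangle ℝ ℂ} (hT : T.Equilateral)
    {i j : Fin 3} (hij : i ≠ j) : dist (T.points i) (T.points j) ^ 2 = 3 * T.circumradius ^ 2 := by
  obtain ⟨a, ha⟩ := hT
  have ha0 : 0 ≤ a := ha i j hij ▸ dist_nonneg
  rw [ha i j hij]
  have h01 := dist_sq_eq (T.points 0) (T.points 1)
  have h02 := dist_sq_eq (T.points 0) (T.points 2)
  have h12 := dist_sq_eq (T.points 1) (T.points 2)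
  rw [ha 0 1 (by decide)] at h01
  rw [ha 0 2 (by decide)] at h02
  rw [ha 1 2 (by decide)] at h12
  set c : ℂ := ⟨((T.points 0).re + (T.points 1).re + (T.points 2).re) / 3,
    ((T.points 0).im + (T.points 1).im + (T.points 2).im) / 3⟩ with hc
  have hmem : c ∈ affineSpan ℝ (range T.points) := by
    rw [T.independent.affineSpan_eq_top_iff_card_eq_finrank_add_one.2
      (by simp [Complex.finrank_real_complex])]
    exact AffineSubspace.mem_top _ _ _
  have hr := T.eq_circumradius_of_dist_eq (r := √(a ^ 2 / 3)) hmem fun k => by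
    have : dist (T.points k) c ^ 2 = a ^ 2 / 3 := by
      rw [dist_sq_eq, hc]
      fin_cases k <;> simp only [Fin.zero_eta, Fin.mk_one, Fin.reduceFinMk] <;> nlinarith
    rw [← this, Real.sqrt_sq dist_nonneg]
  rw [← hr, Real.sq_sqrt (by positivity)]
  ring

lemma dist_eq_sqrt_three_mul_circumradius {T : Affine.Triangle ℝ ℂ} (hT : T.Equilateral)
    {i j : Fin 3} (hij : i ≠ j) : dist (T.points i) (T.points j) = √3 * T.circumradius := by
  have h := dist_sq_eq_three_mul_circumradius_sq hT hij
  rw [← Real.sqrt_sq (dist_nonneg (x := T.points i) (y := T.points j)), h,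
    Real.sqrt_mul (by norm_num), Real.sqrt_sq T.circumradius_nonneg]

/-- AM-GM in two steps. With `x * y` bounded by the square of the mean, the remaining gap is `(z -
3/4) ^ 2 * (3 - z) / 4`. -/
lemma mul_mul_le_of_add_add_le {x y z : ℝ} (hz : 0 ≤ z) (hx : 0 ≤ x) (hy : 0 ≤ y)
    (h : x + y + z ≤ 9 / 4) : x * y * z ≤ 27 / 64 := by
  have h1 : x * y ≤ (9 / 4 - z) ^ 2 / 4 := by nlinarith [sq_nonneg (x - y)]
  have h2 : x * y * z ≤ (9 / 4 - z) ^ 2 / 4 * z := mul_le_mul_of_nonneg_right h1 hz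
  nlinarith [mul_nonneg (sq_nonneg (z - 3 / 4)) (show (0 : ℝ) ≤ 3 - z by linarith)]

lemma one_sub_norm_sq_prod_le {T : Affine.Triangle ℝ ℂ} (hT : T.Equilateral) (hD : InDisk T)
    (hr : 1 / 2 ≤ T.circumradius) :
    (1 - ‖T.points 0‖ ^ 2) * (1 - ‖T.points 1‖ ^ 2) * (1 - ‖T.points 2‖ ^ 2) ≤
      doubleArea (T.points 0) (T.points 1) (T.points 2) ^ 2 := by
  have hpos : ∀ i, 0 ≤ 1 - ‖T.points i‖ ^ 2 := fun i => by
    have := hD.norm_lt i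
    nlinarith [norm_nonneg (T.points i)]
  have h01 := dist_sq_eq_three_mul_circumradius_sq hT (show (0 : Fin 3) ≠ 1 by decide)
  have h02 := dist_sq_eq_three_mul_circumradius_sq hT (show (0 : Fin 3) ≠ 2 by decide)
  have h12 := dist_sq_eq_three_mul_circumradius_sq hT (show (1 : Fin 3) ≠ 2 by decide)
  set s := 3 * T.circumradius ^ 2 with hs
  have hs34 : 3 / 4 ≤ s := by nlinarith
  rw [dist_sq_eq] at h01 h02 h12
  have harea : doubleArea (T.points 0) (T.points 1) (T.points 2) ^ 2 = 3 / 4 * s ^ 2 := by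
    set x1 := (T.points 1).re - (T.points 0).re with hx1
    set y1 := (T.points 1).im - (T.points 0).im with hy1
    set x2 := (T.points 2).re - (T.points 0).re with hx2
    set y2 := (T.points 2).im - (T.points 0).im with hy2
    have e : doubleArea (T.points 0) (T.points 1) (T.points 2) = x1 * y2 - y1 * x2 := by
      simp [doubleArea, hx1, hx2, hy1, hy2]; ring
    have e1 : x1 ^ 2 + y1 ^ 2 = s := by rw [← h01, hx1, hy1]; ring
    have e2 : x2 ^ 2 + y2 ^ 2 = s := by rw [← h02, hx2, hy2]; ring
    have e12 : (x1 - x2) ^ 2 + (y1 - y2) ^ 2 = s := by rw [← h12, hx1, hy1, hx2, hy2]; ring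
    have edot : x1 * x2 + y1 * y2 = s / 2 := by linarith
    have : (x1 * y2 - y1 * x2) ^ 2 =
        (x1 ^ 2 + y1 ^ 2) * (x2 ^ 2 + y2 ^ 2) - (x1 * x2 + y1 * y2) ^ 2 := by ring
    rw [e, this, e1, e2, edot]; ring
  -- The three squared sides add up to three times the right-hand side minus the squared norm of the
  -- sum of the vertices.
  have hsum : s ≤ ‖T.points 0‖ ^ 2 + ‖T.points 1‖ ^ 2 + ‖T.points 2‖ ^ 2 := by
    simp only [norm_sq_eq]
    nlinarith [sq_nonneg ((T.points 0).re + (T.points 1).re + (T.points 2).re),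
      sq_nonneg ((T.points 0).im + (T.points 1).im + (T.points 2).im)]
  rw [harea]
  refine (mul_mul_le_of_add_add_le (hpos 2) (hpos 0) (hpos 1) (by linarith)).trans ?_
  -- Both sides meet at `s = 3/4`, since `3/4 * (3/4) ^ 2 = 27/64`.
  nlinarith

lemma hasRotationNumber_and_exists_circumscribes {T : Affine.Triangle ℝ ℂ} (hT : T.Equilateral)
    (hD : InDisk T) (hr : 1 / 2 ≤ T.circumradius) :
    HasRotationNumber (psi T) (1 / 3) ∧
      ∃ U : Affine.Triangle ℝ ℂ, IsInscribed U ∧ Circumscribes U T := by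
  obtain ⟨x, hx⟩ := exists_tangentLift_iterate_eq hD.norm_lt (one_sub_norm_sq_prod_le hT hD hr)
  exact ⟨hasRotationNumber_one_third hD hx, exists_circumscribes hD hx⟩

/-! ### Small triangles centered at the origin -/

/-- The equilateral triangles centered at the origin. -/
lemma exists_equilateral_norm_eq {r : ℝ} (hr : 0 < r) :
    ∃ T : Affine.Triangle ℝ ℂ, T.Equilateral ∧ (∀ i, ‖T.points i‖ = r) ∧ T.circumradius = r := by
  have h3 : √3 ^ 2 = 3 := Real.sq_sqrt (by norm_num)
  set p : Fin 3 → ℂ := ![⟨r, 0⟩, ⟨-r / 2, r * √3 / 2⟩, ⟨-r / 2, -(r * √3 / 2)⟩] with hp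
  have hn : ∀ i, ‖p i‖ = r := fun i => by
    rw [← Real.sqrt_sq (norm_nonneg (p i)), ← Real.sqrt_sq hr.le, norm_sq_eq]
    congr 1
    fin_cases i <;> simp [hp]
    all_goals linear_combination (r ^ 2 / 4) * h3
  have hd : ∀ i j, i ≠ j → dist (p i) (p j) = √3 * r := fun i j hij => by
    rw [← Real.sqrt_sq (dist_nonneg (x := p i) (y := p j)),
      ← Real.sqrt_sq (show 0 ≤ √3 * r by positivity), dist_sq_eq]
    congr 1
    rw [mul_pow, h3]
    fin_cases i <;> fin_cases j <;>
      first
      | exact absurd rfl hij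
      | simp [hp]; linear_combination (r ^ 2 / 4) * h3
      | simp [hp]; linear_combination (r ^ 2) * h3
  have hinj : Function.Injective p := fun i j hij => by
    by_contra hne
    have := hd i j hne
    rw [hij, dist_self] at this
    have : 0 < √3 * r := by positivity
    linarith
  have he : (triangleOfNorm p r hn hinj).Equilateral := ⟨√3 * r, hd⟩
  refine ⟨triangleOfNorm p r hn hinj, he, hn, ?_⟩
  have h := dist_eq_sqrt_three_mul_circumradius he (show (0 : Fin 3) ≠ 1 by decide)
  exact (mul_left_cancel₀ (by positivity) ((hd 0 1 (by decide)).symm.trans h)).symm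

lemma region_subset_closedBall {T : Affine.Triangle ℝ ℂ} {r : ℝ} (h : ∀ i, ‖T.points i‖ = r) :
    region T ⊆ Metric.closedBall 0 r :=
  region_subset_of_forall_points (convex_closedBall 0 r) fun i => by simp [h i]

/-- The number `1 - conj p * v` lies in the open disk of radius 1/2 about 1, which is seen from the
origin within angle `π / 6` of the real axis. -/
lemma one_third_lt_chordArc {p v : ℂ} (hp : ‖p‖ < 1 / 2) (hv : ‖v‖ = 1) :
    1 / 3 < chordArc p v := by
  have hp1 : ‖p‖ < 1 := by linarith
  have hre := re_one_sub_conj_mul_pos hp1 hv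
  set u := 1 - conj p * v with hu
  have hq : ‖conj p * v‖ ^ 2 < 1 / 4 := by
    rw [norm_mul, hv, mul_one, Complex.norm_conj]
    nlinarith [norm_nonneg p]
  have hu0 : 0 < ‖u‖ := norm_pos_iff.2 (one_sub_conj_mul_ne_zero hp1 hv)
  have him : u.im / ‖u‖ < 1 / 2 := by
    rw [div_lt_iff₀ hu0]
    have h4 : 3 * u.im ^ 2 < u.re ^ 2 := by
      rw [norm_sq_eq] at hq
      simp only [hu, Complex.sub_re, Complex.sub_im, Complex.one_re, Complex.one_im]
      nlinarith [sq_nonneg (2 * (conj p * v).re - 1 / 2)]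
    have h5 := norm_sq_eq u
    by_contra! h6
    nlinarith
  have harg : u.arg < Real.pi / 6 := by
    rw [Complex.arg_of_re_nonneg hre.le, Real.arcsin_lt_iff_lt_sin', Real.sin_pi_div_six]
    · exact him
    · constructor <;> linarith [Real.pi_pos]
  have : u.arg / Real.pi < 1 / 6 := by
    rw [div_lt_iff₀ Real.pi_pos]; linarith
  unfold chordArc
  linarith

lemma exists_one_third_lt_hasRotationNumber {T : Affine.Triangle ℝ ℂ} {r : ℝ} (hr : r < 1 / 2)
    (hD : InDisk T) (h : ∀ i, ‖T.points i‖ = r) :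
    ∃ ρ : ℝ, 1 / 3 < ρ ∧ HasRotationNumber (psi T) ρ := by
  refine ⟨_, ?_, hasRotationNumber_translationNumber hD⟩
  refine CircleDeg1Lift.lt_translationNumber_of_forall_add_lt _
    (continuous_tangentLift hD.norm_lt) fun x => ?_
  obtain ⟨i, hi⟩ := exists_tangentLift_eq T.points x
  rw [tangentDeg1Lift_apply, hi, chordLift]
  have := one_third_lt_chordArc ((h i).trans_lt hr) (Circle.norm_coe (proj x))
  linarith

/-- A chord that comes closer than `1 / 2` to the center spans more than a third of a turn. -/
lemma re_mul_lt_of_mem_segment {u v z : ℂ} (hu : ‖u‖ = 1) (hv : ‖v‖ = 1)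
    (hz : z ∈ segment ℝ u v) (hz2 : ‖z‖ < 1 / 2) : u.re * v.re + u.im * v.im < -(1 / 2) := by
  obtain ⟨a, b, ha, hb, hab, rfl⟩ := hz
  have hu2 := norm_sq_eq u
  have hv2 := norm_sq_eq v
  have hz3 : ‖a • u + b • v‖ ^ 2 < 1 / 4 := by nlinarith [norm_nonneg (a • u + b • v)]
  rw [hu] at hu2
  rw [hv] at hv2
  set d := u.re * v.re + u.im * v.im with hd
  have e : ‖a • u + b • v‖ ^ 2 = a ^ 2 + b ^ 2 + 2 * (a * b) * d := by
    rw [norm_sq_eq]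
    simp only [Complex.add_re, Complex.add_im, Complex.real_smul, Complex.re_ofReal_mul,
      Complex.im_ofReal_mul, hd]
    linear_combination -a ^ 2 * hu2 - b ^ 2 * hv2
  rw [e] at hz3
  obtain rfl : b = 1 - a := by linarith
  have hd1 : d ≤ 1 := by
    rw [hd]; nlinarith [sq_nonneg (u.re - v.re), sq_nonneg (u.im - v.im)]
  -- The squared norm is `(1 + d) / 2 + (2 * a - 1) ^ 2 * (1 - d) / 2`: the midpoint of the chord is
  -- closest to the center.
  nlinarith [mul_nonneg (sq_nonneg (2 * a - 1)) (sub_nonneg.2 hd1)]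

/-- Three unit vectors with pairwise inner products below `-1/2` would have a sum of negative
squared norm. -/
lemma not_exists_circumscribes {T : Affine.Triangle ℝ ℂ} {r : ℝ} (hr : r < 1 / 2)
    (h : ∀ i, ‖T.points i‖ = r) :
    ¬ ∃ U : Affine.Triangle ℝ ℂ, IsInscribed U ∧ Circumscribes U T := by
  rintro ⟨U, hU, -, hside⟩
  have key : ∀ i j, i ≠ j → (U.points i).re * (U.points j).re +
      (U.points i).im * (U.points j).im < -(1 / 2) := fun i j hij => by
    obtain ⟨z, hz, hzT⟩ := hside i j hij
    refine re_mul_lt_of_mem_segment (hU i) (hU j) hz (lt_of_le_of_lt ?_ hr)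
    simpa using region_subset_closedBall h hzT
  have k01 := key 0 1 (by decide)
  have k02 := key 0 2 (by decide)
  have k12 := key 1 2 (by decide)
  have n0 := norm_sq_eq (U.points 0)
  have n1 := norm_sq_eq (U.points 1)
  have n2 := norm_sq_eq (U.points 2)
  rw [hU] at n0 n1 n2
  nlinarith [sq_nonneg ((U.points 0).re + (U.points 1).re + (U.points 2).re),
    sq_nonneg ((U.points 0).im + (U.points 1).im + (U.points 2).im)]

lemma inDisk_of_norm_eq {T : Affine.Triangle ℝ ℂ} {r : ℝ} (hr : r < 1)
    (h : ∀ i, ‖T.points i‖ = r) : InDisk T :=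
  (region_subset_closedBall h).trans (Metric.closedBall_subset_ball hr)

/-! ### Similarity classes and the value of `mu` -/

lemma equilateral_of_similar {S T : Affine.Triangle ℝ ℂ} (hT : T.Equilateral)
    (h : Similar S.points T.points) : S.Equilateral := by
  obtain ⟨c, -, hc⟩ := similar_iff_exists_dist_eq.1 h
  obtain ⟨a, ha⟩ := hT
  exact ⟨c * a, fun i j hij => by rw [hc, ha i j hij]⟩

lemma similar_of_equilateral {S T : Affine.Triangle ℝ ℂ} (hS : S.Equilateral) (hT : T.Equilateral) :
    Similar S.points T.points := by
  rw [similar_iff_exists_pos_pairwise_dist_eq]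
  have hS0 := S.circumradius_pos
  have hT0 := T.circumradius_pos
  refine ⟨S.circumradius / T.circumradius, by positivity, fun i j hij => ?_⟩
  change dist (S.points i) (S.points j) = _ * dist (T.points i) (T.points j)
  rw [dist_eq_sqrt_three_mul_circumradius hS hij, dist_eq_sqrt_three_mul_circumradius hT hij]
  field_simp

lemma congruent_iff_circumradius_eq {S T : Affine.Triangle ℝ ℂ} (hS : S.Equilateral)
    (hT : T.Equilateral) : Congruent S.points T.points ↔ S.circumradius = T.circumradius := by
  rw [congruent_iff_pairwise_dist_eq]
  have h3 : √3 ≠ 0 := by positivity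
  constructor
  · intro h
    have h01 : (0 : Fin 3) ≠ 1 := by decide
    have : dist (S.points 0) (S.points 1) = dist (T.points 0) (T.points 1) := h h01
    rw [dist_eq_sqrt_three_mul_circumradius hS h01,
      dist_eq_sqrt_three_mul_circumradius hT h01] at this
    exact mul_left_cancel₀ h3 this
  · intro h i j hij
    change dist (S.points i) (S.points j) = dist (T.points i) (T.points j)
    rw [dist_eq_sqrt_three_mul_circumradius hS hij, dist_eq_sqrt_three_mul_circumradius hT hij, h]

lemma kappa_eq_circumradius {T : Affine.Triangle ℝ ℂ} (hT : T.Equilateral) :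
    kappa T = T.circumradius :=
  if_pos hT.acuteAngled

lemma mu_eq_one_half {T : Affine.Triangle ℝ ℂ} (hT : T.Equilateral) : mu T = 1 / 2 := by
  refine IsLeast.csInf_eq ⟨?_, ?_⟩
  · obtain ⟨S, hS, hn, hr⟩ := exists_equilateral_norm_eq (r := 1 / 2) (by norm_num)
    refine ⟨S, inDisk_of_norm_eq (by norm_num) hn, similar_of_equilateral hS hT,
      fun R hR hRS => ?_, by rw [kappa_eq_circumradius hS, hr]⟩
    have hRe : R.Equilateral := equilateral_of_similar hS hRS.similar
    have hRr := (congruent_iff_circumradius_eq hRe hS).1 hRS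
    exact (hasRotationNumber_and_exists_circumscribes hRe hR (by rw [hRr, hr])).1
  · rintro _ ⟨S, -, hST, hrot, rfl⟩
    have hS := equilateral_of_similar hT hST
    rw [kappa_eq_circumradius hS]
    by_contra! hlt
    -- The congruent copy centered at the origin has rotation number above 1/3, contradicting the
    -- requirement on all congruent copies.
    obtain ⟨R, hR, hn, hr⟩ := exists_equilateral_norm_eq S.circumradius_pos
    have hD : InDisk R := inDisk_of_norm_eq (by linarith) hn
    obtain ⟨ρ, hρ, h⟩ := exists_one_third_lt_hasRotationNumber hlt hD hn
    exact hρ.ne ((hrot R hD ((congruent_iff_circumradius_eq hR hS).2 hr)).unique h)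

end BarBilliard

theorem proposition5p3 :
    (∀ T : Affine.Triangle ℝ ℂ, T.Equilateral → BarBilliard.mu T = 1 / 2) ∧
    (∀ T : Affine.Triangle ℝ ℂ, T.Equilateral → BarBilliard.InDisk T →
      1 / 2 ≤ T.circumradius →
        BarBilliard.HasRotationNumber (BarBilliard.psi T) (1 / 3) ∧
        ∃ U : Affine.Triangle ℝ ℂ, BarBilliard.IsInscribed U ∧ BarBilliard.Circumscribes U T) ∧
    (∀ r : ℝ, 0 < r → r < 1 / 2 →
      ∃ T : Affine.Triangle ℝ ℂ, T.Equilateral ∧ BarBilliard.InDisk T ∧ T.circumradius = r ∧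
        (∃ ρ : ℝ, 1 / 3 < ρ ∧ BarBilliard.HasRotationNumber (BarBilliard.psi T) ρ) ∧
        ¬ ∃ U : Affine.Triangle ℝ ℂ, BarBilliard.IsInscribed U ∧
          BarBilliard.Circumscribes U T) := by
  refine ⟨fun T hT => BarBilliard.mu_eq_one_half hT,
    fun T hT hD hr => BarBilliard.hasRotationNumber_and_exists_circumscribes hT hD hr,
    fun r hr hr2 => ?_⟩
  obtain ⟨T, hT, hn, hTr⟩ := BarBilliard.exists_equilateral_norm_eq hr
  have hD : BarBilliard.InDisk T := BarBilliard.inDisk_of_norm_eq (by linarith) hn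
  exact ⟨T, hT, hD, hTr, BarBilliard.exists_one_third_lt_hasRotationNumber hr2 hD hn,
    BarBilliard.not_exists_circumscribes hr2 hn⟩
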